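/- Let $n\ge 0$ be an integer and let $\mathrm{Sym}(2^n)$ be the symmetric group on $X_n=\{1,\dots,2^n\}$. For $0\le m\le n$ let $\mathcal B^n_m$ be the partition of $X_n$ into the $2^m$ blocks $\{k2^{n-m}+1,\dots,(k+1)2^{n-m}\}$, $0\le k\le 2^m-1$, and let $\Sigma_n=\bigcap_{m=1}^n \mathrm{Stab}_{\mathrm{Sym}(2^n)}(\mathcal B^n_m)$, where the stabilizer of a partition consists of the permutations that map blocks to blocks. For $n\ge 1$ let $s_n=\prod_{j=1}^{2^{n-1}}(j,\,j+2^{n-1})$, and define recursively $t^n_n=s_n$ and $t^n_i=t^{n-1}_i\cdot s_n^{-1}t^{n-1}_i s_n$ for $1\le i<n$, where $\mathrm{Sym}(2^{n-1})$ is regarded as the subgroup of $\mathrm{Sym}(2^n)$ fixing $2^{n-1}+1,\dots,2^n$ pointwise. Let $T_n=\langle t^n_1,\dots,t^n_n\rangle$ and $U_n=N_{\Sigma_n}(T_n)$. Define the normalizer chain by $N^0_n=U_n$ and $N^k_n=N_{\mathrm{Sym}(2^n)}(N^{k-1}_n)$ for $k\ge 1$. Then $\Sigma_n$ is a Sylow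 $2$-subgroup of $\mathrm{Sym}(2^n)$, and 1. for every $k\ge 1$, $N^k_n=N_{\Sigma_n}(N^{k-1}_n)$; 2. for every $k\ge 0$, $N^k_n$ is contained in $\Sigma_n$ and is a $2$-group; 3. there is $d\in\mathbb N$ (depending on $n$) such that $N^k_n=\Sigma_n$ for all $k\ge d$. -/

import Mathlib

open scoped Pointwise

namespace NormalizerChain

/-- The symmetric group on the `2 ^ n` points `0, …, 2 ^ n - 1`
(the point `x` here stands for `x + 1` in the labelling `1, …, 2 ^ n`). -/
abbrev SymGroup (n : ℕ) : Type := Equiv.Perm (Fin (2 ^ n))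

/-- The block `B_{m,k} = {k * 2 ^ (n - m), …, (k + 1) * 2 ^ (n - m) - 1}`. -/
def block (n m k : ℕ) : Set (Fin (2 ^ n)) :=
  {x | k * 2 ^ (n - m) ≤ (x : ℕ) ∧ (x : ℕ) < (k + 1) * 2 ^ (n - m)}

/-- The partition `{B_{m,0}, …, B_{m,2 ^ m - 1}}` of the set of points, used for `m ≤ n`. -/
def blockSystem (n m : ℕ) : Set (Set (Fin (2 ^ n))) :=
  {B | ∃ k < 2 ^ m, B = block n m k}

/-- `Σ_n`: the intersection of the stabilizers in `Sym(2 ^ n)` of the partitions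
`blockSystem n m`, `1 ≤ m ≤ n` (blocks of a partition may be permuted). -/
def sylowSigma (n : ℕ) : Subgroup (SymGroup n) :=
  ⨅ m ∈ Set.Icc 1 n, MulAction.stabilizer (SymGroup n) (blockSystem n m)

/-- The permutation `s_n` of `Sym(2 ^ n)` for `n ≥ 1`, the product of the pairwise disjoint
transpositions `(j, j + 2 ^ (n - 1))` with `0 ≤ j < 2 ^ (n - 1)`. -/
def halfSwap (n : ℕ) : SymGroup n :=
  ((List.range (2 ^ (n - 1))).map fun j =>
    Equiv.swap (Fin.ofNat (2 ^ n) j) (Fin.ofNat (2 ^ n) (j + 2 ^ (n - 1)))).prod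

/-- A permutation of the first `2 ^ n` points, seen as a permutation of `2 ^ (n + 1)` points
that fixes the remaining ones. -/
def extend {n : ℕ} (g : SymGroup n) : SymGroup (n + 1) :=
  g.viaFintypeEmbedding (Fin.castLEEmb (Nat.pow_le_pow_right Nat.two_pos n.le_succ))

/-- The generators `t_i` (`1 ≤ i ≤ n`) of `T_n`: `t_n = s_n` at level `n`, and for `i < n` the
product of the generator `t_i` of level `n - 1` and of its conjugate by `s_n`. -/
def tGen : (n : ℕ) → ℕ → SymGroup n
  | 0, _ => 1
  | n + 1, i =>
    if i = n + 1 then halfSwap (n + 1)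
    else extend (tGen n i) *
      ((halfSwap (n + 1))⁻¹ * extend (tGen n i) * halfSwap (n + 1))

/-- `T_n = ⟨t_1, …, t_n⟩`. -/
def translationGroup (n : ℕ) : Subgroup (SymGroup n) :=
  Subgroup.closure (tGen n '' Set.Icc 1 n)

/-- `N_K(H) = {g ∈ K | g H g⁻¹ = H}`. -/
def normalizerIn {G : Type*} [Group G] (K H : Subgroup G) : Subgroup G :=
  K ⊓ Subgroup.normalizer (H : Set G)

/-- `U_n = N_{Σ_n}(T_n)`. -/
def sylowU (n : ℕ) : Subgroup (SymGroup n) :=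
  normalizerIn (sylowSigma n) (translationGroup n)

/-- The normalizer chain: `N^0 = U_n` and `N^k` is the normalizer of `N^{k-1}` in the whole
symmetric group `Sym(2 ^ n)`, for `k ≥ 1`. -/
def normalizerChain (n : ℕ) : ℕ → Subgroup (SymGroup n)
  | 0 => sylowU n
  | k + 1 => Subgroup.normalizer (normalizerChain n k : Set (SymGroup n))

end NormalizerChain

/-!
Write `Σ` for `sylowSigma n` and `U` for `sylowU n`. The group `Σ` consists of the permutations
that preserve, for every `d`, the relation `E_d` of lying in the same block of size `2 ^ d`. Let
`U ≤ H ≤ Σ`. A permutation `g` normalizing `H` permutes the `H`-invariant equivalence relations.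
Among them are the `E_d`, and every `H`-invariant relation is comparable with each `E_d`, because
`U` contains the translations `x ↦ x + c` of `𝔽₂ⁿ` and enough transvections: an invariant relation
not finer than `E_d` relates `0` to some `z` with digit `1` at a position `j ≥ d`, hence also to
`z + c`, and therefore to `c`, for every `c < 2 ^ j`. On a finite set an invertible `g` mapping
`E_d` to a relation comparable with `E_d` preserves it, so the normalizer of `H` lies in `Σ`.

For `H = Σ` this says that the `2`-group `Σ` is self-normalizing, hence Sylow, as normalizers grow
in nilpotent groups. The same growth forces the chain, which never leaves `Σ`, to end at `Σ`.
-/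

namespace NormalizerChain

section Group

variable {G : Type*} [Group G]

theorem eq_of_normalizerIn_le {H P : Subgroup G} (hP : NormalizerCondition P) (hHP : H ≤ P)
    (hN : normalizerIn P H ≤ H) : H = P := by
  have hself : Subgroup.normalizer (H.subgroupOf P : Set P) = H.subgroupOf P := by
    rw [← Subgroup.subgroupOf_normalizer_eq hHP, ← Subgroup.inf_subgroupOf_left]
    exact congrArg (Subgroup.subgroupOf · P) (hN.antisymm (le_inf hHP Subgroup.le_normalizer))
  exact le_antisymm hHP (Subgroup.subgroupOf_eq_top.mp
    (normalizerCondition_iff_only_full_group_self_normalizing.mp hP _ hself))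

variable [Finite G] {p : ℕ} [Fact p.Prime]

theorem normalizerCondition_of_isPGroup (hG : IsPGroup p G) : NormalizerCondition G :=
  have := hG.isNilpotent
  Group.normalizerCondition_of_isNilpotent

theorem exists_sylow_eq_of_normalizer_le {H : Subgroup G} (hH : IsPGroup p H)
    (hN : Subgroup.normalizer (H : Set G) ≤ H) : ∃ P : Sylow p G, (P : Subgroup G) = H := by
  obtain ⟨P, hHP⟩ := hH.exists_le_sylow
  exact ⟨P, (eq_of_normalizerIn_le (normalizerCondition_of_isPGroup P.isPGroup') hHP
    (inf_le_right.trans hN)).symm⟩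

end Group

theorem prod_eq_of_pairwise_disjoint {α : Type*} [Finite α] {l : List (Equiv.Perm α)}
    (hl : l.Pairwise Equiv.Perm.Disjoint) {σ : Equiv.Perm α}
    (hσ : ∀ x, ∃ f ∈ l, f x ≠ x ∧ f x = σ x) : l.prod = σ := by
  classical
  have := Fintype.ofFinite α
  refine Equiv.ext fun x => ?_
  obtain ⟨f, hf, hne, hfx⟩ := hσ x
  rw [← hfx, Equiv.Perm.eq_on_support_mem_disjoint hf hl x (Equiv.Perm.mem_support.mpr hne)]

section SetoidStabilizer

variable {α : Type*}

/-- The permutations preserving an equivalence relation `r`, that is, mapping classes of `r` onto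
classes of `r`. -/
def setoidStabilizer (r : Setoid α) : Subgroup (Equiv.Perm α) where
  carrier := {g | ∀ x y, r (g x) (g y) ↔ r x y}
  one_mem' _ _ := Iff.rfl
  mul_mem' hg hh x y := (hg _ _).trans (hh x y)
  inv_mem' {g} hg x y := by simpa using (hg (g⁻¹ x) (g⁻¹ y)).symm

theorem mem_setoidStabilizer {r : Setoid α} {g : Equiv.Perm α} :
    g ∈ setoidStabilizer r ↔ ∀ x y, r (g x) (g y) ↔ r x y :=
  Iff.rfl

theorem setoidStabilizer_top : setoidStabilizer (⊤ : Setoid α) = ⊤ :=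
  eq_top_iff.mpr fun _ _ _ _ => Iff.rfl

theorem smul_classes (g : Equiv.Perm α) (r : Setoid α) :
    g • r.classes = (r.comap ⇑g⁻¹).classes := by
  ext B
  constructor
  · rintro ⟨_, ⟨y, rfl⟩, rfl⟩
    exact ⟨g y, by ext x; simp [Set.mem_smul_set_iff_inv_smul_mem, Setoid.comap_rel]⟩
  · rintro ⟨y, rfl⟩
    exact ⟨_, ⟨g⁻¹ y, rfl⟩, by ext x; simp [Set.mem_smul_set_iff_inv_smul_mem, Setoid.comap_rel]⟩

theorem stabilizer_classes (r : Setoid α) :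
    MulAction.stabilizer (Equiv.Perm α) r.classes = setoidStabilizer r := by
  ext g
  rw [MulAction.mem_stabilizer_iff, smul_classes, ← Setoid.classes_inj, ← inv_mem_iff (x := g),
    mem_setoidStabilizer, Setoid.ext_iff]
  rfl

theorem mem_setoidStabilizer_of_le_comap [Finite α] {r : Setoid α} {g : Equiv.Perm α}
    (h : r ≤ r.comap g) : g ∈ setoidStabilizer r := by
  have hpow (k : ℕ) : r ≤ r.comap ⇑(g ^ k) := by
    induction k with
    | zero => exact le_rfl
    | succ k ih =>
      rw [pow_succ]
      exact fun x y hxy => ih (h hxy)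
  obtain ⟨k, hk⟩ := mem_powers_iff_mem_zpowers.mpr (inv_mem (Subgroup.mem_zpowers g))
  refine fun x y => ⟨fun hxy => ?_, fun hxy => h hxy⟩
  simpa [show g ^ k = g⁻¹ from hk, Setoid.comap_rel] using hpow k hxy

theorem le_setoidStabilizer_comap {H : Subgroup (Equiv.Perm α)} {r : Setoid α}
    (hr : H ≤ setoidStabilizer r) {g : Equiv.Perm α}
    (hg : g ∈ Subgroup.normalizer (H : Set (Equiv.Perm α))) :
    H ≤ setoidStabilizer (r.comap g) := by
  intro h hh x y
  have hconj : g * h * g⁻¹ ∈ H := (Subgroup.mem_normalizer_iff.mp hg h).mp hh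
  simpa [Setoid.comap_rel] using hr hconj (g x) (g y)

theorem normalizer_le_setoidStabilizer [Finite α] {H : Subgroup (Equiv.Perm α)} {r : Setoid α}
    (hr : H ≤ setoidStabilizer r)
    (hcomp : ∀ s : Setoid α, H ≤ setoidStabilizer s → s ≤ r ∨ r ≤ s) :
    Subgroup.normalizer (H : Set (Equiv.Perm α)) ≤ setoidStabilizer r := by
  intro g hg
  rcases hcomp _ (le_setoidStabilizer_comap hr hg) with hle | hle
  · refine inv_mem_iff.mp (mem_setoidStabilizer_of_le_comap fun x y hxy => hle ?_)
    simpa [Setoid.comap_rel] using hxy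
  · exact mem_setoidStabilizer_of_le_comap hle

end SetoidStabilizer

section Blocks

variable {n : ℕ}

/-- The equivalence relation on the points whose classes are the blocks of size `2 ^ d`: two points
are equivalent when their binary digits agree from position `d` on. -/
def blockSetoid (n d : ℕ) : Setoid (Fin (2 ^ n)) :=
  Setoid.ker fun x => (x : ℕ) / 2 ^ d

theorem blockSetoid_iff_div_eq {d : ℕ} {x y : Fin (2 ^ n)} :
    blockSetoid n d x y ↔ (x : ℕ) / 2 ^ d = (y : ℕ) / 2 ^ d :=
  Iff.rfl

theorem blockSetoid_iff_xor_lt {d : ℕ} {x y : Fin (2 ^ n)} :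
    blockSetoid n d x y ↔ ((x ^^^ y : Fin (2 ^ n)) : ℕ) < 2 ^ d := by
  rw [blockSetoid_iff_div_eq, ← Nat.xor_eq_zero_iff, ← Nat.xor_div_two_pow,
    Nat.div_eq_zero_iff_lt (Nat.two_pow_pos d), Fin.xor_val_of_two_pow]

theorem blockSetoid_zero : blockSetoid n 0 = ⊥ := by
  ext x y
  simp [blockSetoid_iff_div_eq, Fin.ext_iff]

theorem blockSetoid_eq_top {d : ℕ} (hd : n ≤ d) : blockSetoid n d = ⊤ := by
  refine eq_top_iff.mpr fun x y _ => blockSetoid_iff_xor_lt.mpr ?_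
  exact (x ^^^ y).is_lt.trans_le (Nat.pow_le_pow_right two_pos hd)

theorem mem_block_iff {m k : ℕ} {x : Fin (2 ^ n)} :
    x ∈ block n m k ↔ (x : ℕ) / 2 ^ (n - m) = k := by
  have hpos : 0 < 2 ^ (n - m) := Nat.two_pow_pos _
  rw [block, Set.mem_ofPred_eq, Nat.div_eq_iff hpos, Nat.succ_mul]
  omega

theorem blockSystem_eq_classes {m : ℕ} (hm : m ≤ n) :
    blockSystem n m = (blockSetoid n (n - m)).classes := by
  have hpow : 2 ^ m * 2 ^ (n - m) = 2 ^ n := by rw [← pow_add, Nat.add_sub_cancel' hm]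
  ext B
  constructor
  · rintro ⟨k, hk, rfl⟩
    have hlt : k * 2 ^ (n - m) < 2 ^ n := by rw [← hpow]; gcongr
    refine ⟨⟨k * 2 ^ (n - m), hlt⟩, Set.ext fun x => ?_⟩
    simp [mem_block_iff, blockSetoid_iff_div_eq]
  · rintro ⟨y, rfl⟩
    refine ⟨(y : ℕ) / 2 ^ (n - m), ?_, Set.ext fun x => mem_block_iff.symm⟩
    rw [Nat.div_lt_iff_lt_mul (Nat.two_pow_pos _), hpow]
    exact y.is_lt

theorem mem_sylowSigma_iff {g : SymGroup n} :
    g ∈ sylowSigma n ↔ ∀ d, g ∈ setoidStabilizer (blockSetoid n d) := by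
  simp only [sylowSigma, Subgroup.mem_iInf, Set.mem_Icc]
  constructor
  · intro hg d
    rcases le_or_gt n d with hd | hd
    · rw [blockSetoid_eq_top hd, setoidStabilizer_top]
      exact Subgroup.mem_top g
    · have hstab := hg (n - d) (by omega)
      rwa [blockSystem_eq_classes (Nat.sub_le n d), stabilizer_classes,
        Nat.sub_sub_self hd.le] at hstab
  · rintro hg m ⟨-, hm⟩
    rw [blockSystem_eq_classes hm, stabilizer_classes]
    exact hg (n - m)

-- A block of size `2 ^ (d + 1)` consists of two blocks of size `2 ^ d`, which `g` fixes or swaps.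
theorem blockSetoid_sq_apply {d : ℕ} {g : SymGroup n}
    (hg : g ∈ setoidStabilizer (blockSetoid n d)) (hfix : ∀ x, blockSetoid n (d + 1) (g x) x)
    (x : Fin (2 ^ n)) : blockSetoid n d ((g ^ 2) x) x := by
  have hiff := hg (g x) x
  have hx := hfix x
  have hgx := hfix (g x)
  simp only [blockSetoid_iff_div_eq, pow_succ, ← Nat.div_div_eq_div_mul] at hiff hx hgx ⊢
  simp only [pow_zero, one_mul, Equiv.Perm.mul_apply]
  omega

theorem blockSetoid_pow_two_pow_apply {g : SymGroup n} (hg : g ∈ sylowSigma n) {d m : ℕ}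
    (hdm : n ≤ d + m) (x : Fin (2 ^ n)) : blockSetoid n d ((g ^ 2 ^ m) x) x := by
  induction m generalizing d x with
  | zero =>
    rw [blockSetoid_eq_top (d := d) hdm]
    trivial
  | succ m ih =>
    rw [pow_succ, pow_mul]
    exact blockSetoid_sq_apply (mem_sylowSigma_iff.mp (pow_mem hg _) d)
      (ih (by omega)) x

theorem isPGroup_sylowSigma (n : ℕ) : IsPGroup 2 (sylowSigma n) := by
  rintro ⟨g, hg⟩
  refine ⟨n, Subtype.ext (Equiv.ext fun x => ?_)⟩
  have h := blockSetoid_pow_two_pow_apply hg (zero_add n).ge x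
  rwa [blockSetoid_zero] at h

end Blocks

section TranslationsAndShears

variable {n : ℕ}

theorem xor_xor_cancel_right (a b : Fin (2 ^ n)) : a ^^^ b ^^^ b = a :=
  Fin.ext (by simp)

theorem xor_xor_cancel_left (a b : Fin (2 ^ n)) : a ^^^ (a ^^^ b) = b :=
  Fin.ext (by simp)

/-- The translation `x ↦ x + c` of the points, seen as the vector space `𝔽₂ⁿ` through their binary
digits. -/
def translation (c : Fin (2 ^ n)) : SymGroup n :=
  Function.Involutive.toPerm (· ^^^ c) fun x => xor_xor_cancel_right x c

theorem translation_apply (c x : Fin (2 ^ n)) : translation c x = x ^^^ c :=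
  rfl

theorem translation_zero : translation (0 : Fin (2 ^ n)) = 1 :=
  Equiv.ext fun x => Fin.xor_zero x

theorem translation_xor (a b : Fin (2 ^ n)) :
    translation (a ^^^ b) = translation a * translation b := by
  ext x
  simp [translation_apply, Nat.xor_comm, Nat.xor_left_comm]

theorem translation_inv (c : Fin (2 ^ n)) : (translation c)⁻¹ = translation c :=
  rfl

theorem translation_mem_sylowSigma (c : Fin (2 ^ n)) : translation c ∈ sylowSigma n := by
  refine mem_sylowSigma_iff.mpr fun d x y => ?_
  have hxor : x ^^^ c ^^^ (y ^^^ c) = x ^^^ y := Fin.ext (by simp [Nat.xor_assoc, Nat.xor_comm c])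
  rw [blockSetoid_iff_xor_lt, blockSetoid_iff_xor_lt, translation_apply, translation_apply, hxor]

/-- The transvection `x ↦ x + xⱼ c` of `𝔽₂ⁿ`, where `xⱼ` is the binary digit of `x` at position `j`
and `cⱼ = 0`. -/
def shear (j : ℕ) (c : Fin (2 ^ n)) (hc : (c : ℕ).testBit j = false) : SymGroup n :=
  Function.Involutive.toPerm (fun x => if (x : ℕ).testBit j then x ^^^ c else x) fun x => by
    by_cases hx : (x : ℕ).testBit j <;> simp [hx, hc]

variable {j : ℕ} {c : Fin (2 ^ n)} (hc : (c : ℕ).testBit j = false)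

theorem shear_apply (x : Fin (2 ^ n)) :
    shear j c hc x = if (x : ℕ).testBit j then x ^^^ c else x :=
  rfl

theorem shear_xor (x y : Fin (2 ^ n)) :
    shear j c hc (x ^^^ y) = shear j c hc x ^^^ shear j c hc y := by
  by_cases hx : (x : ℕ).testBit j <;> by_cases hy : (y : ℕ).testBit j <;>
    simp [shear_apply, hx, hy, Fin.ext_iff, Nat.xor_comm, Nat.xor_left_comm]

theorem shear_mul_translation_mul_inv (e : Fin (2 ^ n)) :
    shear j c hc * translation e * (shear j c hc)⁻¹ = translation (shear j c hc e) := by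
  ext x
  simp [translation_apply, shear_xor, Equiv.Perm.mul_apply]

theorem shear_lt_two_pow (hcj : (c : ℕ) < 2 ^ j) {d : ℕ} {z : Fin (2 ^ n)} (hz : (z : ℕ) < 2 ^ d) :
    (shear j c hc z : ℕ) < 2 ^ d := by
  rw [shear_apply]
  split_ifs with hbit
  · have hjd : 2 ^ j < 2 ^ d := (Nat.ge_two_pow_of_testBit hbit).trans_lt hz
    simpa using Nat.xor_lt_two_pow hz (hcj.trans hjd)
  · exact hz

theorem shear_mem_sylowSigma (hcj : (c : ℕ) < 2 ^ j) : shear j c hc ∈ sylowSigma n := by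
  refine mem_sylowSigma_iff.mpr fun d => mem_setoidStabilizer_of_le_comap fun x y hxy => ?_
  rw [blockSetoid_iff_xor_lt] at hxy
  rw [Setoid.comap_rel, blockSetoid_iff_xor_lt, ← shear_xor]
  exact shear_lt_two_pow hc hcj hxy

end TranslationsAndShears

section TranslationGroup

variable {n : ℕ}

theorem add_two_pow_eq_xor {x : ℕ} (hx : x < 2 ^ n) : x + 2 ^ n = x ^^^ 2 ^ n := by
  have hdiv : (x ^^^ 2 ^ n) / 2 ^ n = 1 := by
    rw [Nat.xor_div_two_pow, Nat.div_eq_of_lt hx, Nat.div_self (Nat.two_pow_pos n), Nat.zero_xor]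
  have hmod : (x ^^^ 2 ^ n) % 2 ^ n = x := by
    rw [Nat.xor_mod_two_pow, Nat.mod_eq_of_lt hx, Nat.mod_self, Nat.xor_zero]
  have h := Nat.div_add_mod (x ^^^ 2 ^ n) (2 ^ n)
  rw [hdiv, hmod] at h
  omega

theorem xor_two_pow_eq_sub {x : ℕ} (hx : 2 ^ n ≤ x) (hx' : x < 2 ^ (n + 1)) :
    x ^^^ 2 ^ n = x - 2 ^ n := by
  have h := add_two_pow_eq_xor (n := n) (x := x - 2 ^ n) (by omega)
  rw [Nat.sub_add_cancel hx] at h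
  calc x ^^^ 2 ^ n = x - 2 ^ n ^^^ 2 ^ n ^^^ 2 ^ n := by rw [← h]
    _ = x - 2 ^ n := Nat.xor_xor_cancel_right _ _

/-- The list of the transpositions `(j, j + 2 ^ n)`, `0 ≤ j < 2 ^ n`, whose product is
`halfSwap (n + 1)`. -/
def halfSwapFactors (n : ℕ) : List (SymGroup (n + 1)) :=
  (List.range (2 ^ n)).map fun j =>
    Equiv.swap (Fin.ofNat (2 ^ (n + 1)) j) (Fin.ofNat (2 ^ (n + 1)) (j + 2 ^ n))

theorem pairwise_disjoint_halfSwapFactors (n : ℕ) :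
    (halfSwapFactors n).Pairwise Equiv.Perm.Disjoint := by
  rw [halfSwapFactors, List.pairwise_map]
  refine List.pairwise_lt_range.imp_of_mem fun {i j} hi hj hij => ?_
  rw [List.mem_range] at hi hj
  apply Equiv.Perm.disjoint_swap_swap
  have hval {k : ℕ} (hk : k < 2 ^ (n + 1)) : (Fin.ofNat (2 ^ (n + 1)) k : ℕ) = k :=
    Nat.mod_eq_of_lt hk
  simp only [List.nodup_cons, List.mem_cons, List.not_mem_nil, List.nodup_nil, Fin.ext_iff]
  rw [hval (k := i), hval (k := j), hval (k := i + 2 ^ n), hval (k := j + 2 ^ n)] <;> grind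

/-- The point `2 ^ i`, that is, the `i`-th vector of the standard basis of `𝔽₂ⁿ`. -/
def basisPoint (n i : ℕ) (hi : i < n) : Fin (2 ^ n) :=
  ⟨2 ^ i, Nat.pow_lt_pow_right one_lt_two hi⟩

theorem swap_xor_mem_halfSwapFactors (x : Fin (2 ^ (n + 1))) :
    Equiv.swap x (x ^^^ basisPoint (n + 1) n n.lt_succ_self) ∈ halfSwapFactors n := by
  rw [halfSwapFactors, List.mem_map]
  rcases lt_or_ge (x : ℕ) (2 ^ n) with hx | hx
  · refine ⟨x, List.mem_range.mpr hx, ?_⟩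
    congr 1 <;> ext
    · exact Nat.mod_eq_of_lt x.is_lt
    · rw [Fin.xor_val_of_two_pow, Fin.val_ofNat, Nat.mod_eq_of_lt (by omega)]
      exact add_two_pow_eq_xor hx
  · refine ⟨x - 2 ^ n, List.mem_range.mpr (by omega), ?_⟩
    rw [Equiv.swap_comm]
    congr 1 <;> ext
    · rw [Nat.sub_add_cancel hx]
      exact Nat.mod_eq_of_lt x.is_lt
    · rw [Fin.xor_val_of_two_pow, Fin.val_ofNat, Nat.mod_eq_of_lt (by omega)]
      exact (xor_two_pow_eq_sub hx x.is_lt).symm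

theorem halfSwap_succ (n : ℕ) :
    halfSwap (n + 1) = translation (basisPoint (n + 1) n n.lt_succ_self) := by
  refine prod_eq_of_pairwise_disjoint (pairwise_disjoint_halfSwapFactors n) fun x =>
    ⟨_, swap_xor_mem_halfSwapFactors x, ?_, Equiv.swap_apply_left _ _⟩
  rw [Equiv.swap_apply_left, ne_eq, Fin.ext_iff, Fin.xor_val_of_two_pow]
  simp [basisPoint]

theorem extend_apply_of_lt (g : SymGroup n) {x : Fin (2 ^ (n + 1))} (hx : (x : ℕ) < 2 ^ n) :
    (extend g x : ℕ) = g ⟨x, hx⟩ :=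
  congrArg Fin.val (g.viaFintypeEmbedding_apply_image (Fin.castLEEmb _) ⟨x, hx⟩)

theorem extend_apply_of_le (g : SymGroup n) {x : Fin (2 ^ (n + 1))} (hx : 2 ^ n ≤ (x : ℕ)) :
    extend g x = x := by
  refine g.viaFintypeEmbedding_apply_notMem_range _ ?_
  rintro ⟨y, rfl⟩
  exact hx.not_gt y.is_lt

theorem extend_translation_apply_of_lt (c : Fin (2 ^ n)) {x : Fin (2 ^ (n + 1))}
    (hx : (x : ℕ) < 2 ^ n) : (extend (translation c) x : ℕ) = x ^^^ c := by
  rw [extend_apply_of_lt _ hx, translation_apply, Fin.xor_val_of_two_pow]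

theorem two_pow_le_xor_basisPoint {x : Fin (2 ^ (n + 1))} (hx : (x : ℕ) < 2 ^ n) :
    2 ^ n ≤ ((x ^^^ basisPoint (n + 1) n n.lt_succ_self : Fin (2 ^ (n + 1))) : ℕ) := by
  rw [Fin.xor_val_of_two_pow]
  exact (Nat.le_add_left _ _).trans_eq (add_two_pow_eq_xor hx)

theorem xor_basisPoint_lt_two_pow {x : Fin (2 ^ (n + 1))} (hx : 2 ^ n ≤ (x : ℕ)) :
    ((x ^^^ basisPoint (n + 1) n n.lt_succ_self : Fin (2 ^ (n + 1))) : ℕ) < 2 ^ n := by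
  rw [Fin.xor_val_of_two_pow]
  exact (xor_two_pow_eq_sub hx x.is_lt).trans_lt (by omega)

theorem extend_mul_conj_halfSwap {i : ℕ} (hi : i < n) :
    extend (translation (basisPoint n i hi)) *
      ((halfSwap (n + 1))⁻¹ * extend (translation (basisPoint n i hi)) * halfSwap (n + 1)) =
    translation (basisPoint (n + 1) i (hi.trans n.lt_succ_self)) := by
  rw [halfSwap_succ, translation_inv]
  refine Equiv.ext fun x => ?_
  simp only [Equiv.Perm.mul_apply, translation_apply]
  rcases lt_or_ge (x : ℕ) (2 ^ n) with hx | hx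
  · rw [extend_apply_of_le _ (two_pow_le_xor_basisPoint hx), xor_xor_cancel_right]
    ext
    rw [extend_translation_apply_of_lt _ hx, Fin.xor_val_of_two_pow]
    rfl
  · have hlt := xor_basisPoint_lt_two_pow hx
    have hval := extend_translation_apply_of_lt (basisPoint n i hi) hlt
    have hval_lt : (extend (translation (basisPoint n i hi)) _ : ℕ) < 2 ^ n :=
      hval.trans_lt (Nat.xor_lt_two_pow hlt (basisPoint n i hi).is_lt)
    rw [extend_apply_of_le _ (two_pow_le_xor_basisPoint hval_lt)]
    ext
    simp only [Fin.xor_val_of_two_pow, hval]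
    simp [basisPoint, Nat.xor_comm, Nat.xor_left_comm]

theorem tGen_succ {i : ℕ} (hi : i < n) : tGen n (i + 1) = translation (basisPoint n i hi) := by
  induction n with
  | zero => exact absurd hi i.not_lt_zero
  | succ n ih =>
    rw [tGen]
    split_ifs with h
    · obtain rfl : i = n := Nat.succ_injective h
      exact halfSwap_succ i
    · have hin : i < n := by omega
      rw [ih hin, extend_mul_conj_halfSwap]

theorem translation_mem_translationGroup (c : Fin (2 ^ n)) :
    translation c ∈ translationGroup n := by
  suffices h : ∀ k ≤ n, ∀ c : Fin (2 ^ n), (c : ℕ) < 2 ^ k → translation c ∈ translationGroup n from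
    h n le_rfl c c.is_lt
  intro k
  induction k with
  | zero =>
    intro _ c hc
    obtain rfl : c = 0 := Fin.ext (by simpa using hc)
    rw [translation_zero]
    exact one_mem _
  | succ k ih =>
    intro hk c hck
    rcases lt_or_ge (c : ℕ) (2 ^ k) with hlt | hge
    · exact ih (by omega) c hlt
    · set e := basisPoint n k hk
      have hgen : translation e ∈ translationGroup n :=
        Subgroup.subset_closure ⟨k + 1, ⟨k.succ_pos, hk⟩, tGen_succ hk⟩
      have hval : ((c ^^^ e : Fin (2 ^ n)) : ℕ) = c - 2 ^ k := by
        rw [Fin.xor_val_of_two_pow]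
        exact xor_two_pow_eq_sub hge hck
      have hc : c = c ^^^ e ^^^ e := (xor_xor_cancel_right c e).symm
      rw [hc, translation_xor]
      exact mul_mem (ih (by omega) _ (by omega)) hgen

theorem mem_translationGroup_iff {t : SymGroup n} :
    t ∈ translationGroup n ↔ ∃ c, t = translation c := by
  constructor
  · intro ht
    induction ht using Subgroup.closure_induction with
    | mem _ h =>
      obtain ⟨i, ⟨hi, hin⟩, rfl⟩ := h
      obtain ⟨i, rfl⟩ := Nat.exists_eq_succ_of_ne_zero (Nat.one_le_iff_ne_zero.mp hi)
      exact ⟨_, tGen_succ hin⟩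
    | one => exact ⟨0, translation_zero.symm⟩
    | mul _ _ _ _ ha hb =>
      obtain ⟨⟨a, rfl⟩, b, rfl⟩ := And.intro ha hb
      exact ⟨a ^^^ b, (translation_xor a b).symm⟩
    | inv _ _ ha =>
      obtain ⟨a, rfl⟩ := ha
      exact ⟨a, translation_inv a⟩
  · rintro ⟨c, rfl⟩
    exact translation_mem_translationGroup c

theorem translation_mem_sylowU (c : Fin (2 ^ n)) : translation c ∈ sylowU n :=
  ⟨translation_mem_sylowSigma c, Subgroup.le_normalizer (translation_mem_translationGroup c)⟩

theorem shear_mem_sylowU {j : ℕ} {c : Fin (2 ^ n)} (hc : (c : ℕ).testBit j = false)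
    (hcj : (c : ℕ) < 2 ^ j) : shear j c hc ∈ sylowU n := by
  refine ⟨shear_mem_sylowSigma hc hcj, Subgroup.mem_normalizer_fintype fun t ht => ?_⟩
  obtain ⟨e, rfl⟩ := mem_translationGroup_iff.mp ht
  rw [shear_mul_translation_mul_inv]
  exact translation_mem_translationGroup _

end TranslationGroup

section Normalizer

variable {n : ℕ}

theorem le_blockSetoid_or_blockSetoid_le {r : Setoid (Fin (2 ^ n))}
    (hr : sylowU n ≤ setoidStabilizer r) (d : ℕ) : r ≤ blockSetoid n d ∨ blockSetoid n d ≤ r := by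
  refine or_iff_not_imp_left.mpr fun hle x y hxy => ?_
  have htrans (e : Fin (2 ^ n)) {u v} (huv : r u v) : r (u ^^^ e) (v ^^^ e) :=
    (hr (translation_mem_sylowU e) u v).mpr huv
  have hzero (u v) : r u v ↔ r (u ^^^ v) 0 := by
    refine ⟨fun h => ?_, fun h => ?_⟩
    · simpa using htrans v h
    · simpa [xor_xor_cancel_right] using htrans v h
  obtain ⟨a, b, hab, hnab⟩ : ∃ a b, r a b ∧ ¬ blockSetoid n d a b := by
    simpa [Setoid.le_def] using hle
  rw [blockSetoid_iff_xor_lt] at hxy hnab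
  rw [hzero] at hab ⊢
  generalize a ^^^ b = z at hab hnab
  generalize x ^^^ y = c at hxy ⊢
  obtain ⟨j, hdj, hzj⟩ := Nat.exists_ge_and_testBit_of_ge_two_pow (not_lt.mp hnab)
  have hcj : (c : ℕ) < 2 ^ j := hxy.trans_le (Nat.pow_le_pow_right two_pos hdj)
  have hcbit : (c : ℕ).testBit j = false := Nat.testBit_lt_two_pow hcj
  have hzc : r (z ^^^ c) 0 := by
    simpa [shear_apply, hzj] using (hr (shear_mem_sylowU hcbit hcj) z 0).mpr hab
  simpa [xor_xor_cancel_left] using (hzero _ _).mp (r.trans hab (r.symm hzc))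

theorem normalizer_le_sylowSigma {H : Subgroup (SymGroup n)} (hU : sylowU n ≤ H)
    (hS : H ≤ sylowSigma n) : Subgroup.normalizer (H : Set (SymGroup n)) ≤ sylowSigma n := by
  refine fun g hg => mem_sylowSigma_iff.mpr fun d => ?_
  exact normalizer_le_setoidStabilizer (fun h hh => mem_sylowSigma_iff.mp (hS hh) d)
    (fun s hs => le_blockSetoid_or_blockSetoid_le (hU.trans hs) d) hg

variable (n)

theorem normalizerChain_monotone : Monotone (normalizerChain n) :=
  monotone_nat_of_le_succ fun _ => Subgroup.le_normalizer

theorem normalizerChain_le_sylowSigma (k : ℕ) : normalizerChain n k ≤ sylowSigma n := by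
  induction k with
  | zero => exact inf_le_left
  | succ k ih => exact normalizer_le_sylowSigma (normalizerChain_monotone n k.zero_le) ih

theorem exists_normalizerChain_eq_sylowSigma :
    ∃ d, ∀ k, d ≤ k → normalizerChain n k = sylowSigma n := by
  obtain ⟨d, hd⟩ := WellFoundedGT.monotone_chain_condition
    (⟨normalizerChain n, normalizerChain_monotone n⟩ : ℕ →o Subgroup (SymGroup n))
  have hnormalizer : normalizerChain n (d + 1) ≤ normalizerChain n d := (hd (d + 1) d.le_succ).ge
  have hSigma : normalizerChain n d = sylowSigma n :=
    eq_of_normalizerIn_le (normalizerCondition_of_isPGroup (isPGroup_sylowSigma n))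
      (normalizerChain_le_sylowSigma n d) (inf_le_right.trans hnormalizer)
  exact ⟨d, fun k hk => (hd k hk).symm.trans hSigma⟩

end Normalizer

end NormalizerChain

theorem mainTheorem2 (n : ℕ) :
    (∃ P : Sylow 2 (NormalizerChain.SymGroup n),
      (P : Subgroup (NormalizerChain.SymGroup n)) = NormalizerChain.sylowSigma n) ∧
    (∀ k : ℕ, 1 ≤ k →
      NormalizerChain.normalizerChain n k =
        NormalizerChain.normalizerIn (NormalizerChain.sylowSigma n)
          (NormalizerChain.normalizerChain n (k - 1))) ∧
    (∀ k : ℕ, NormalizerChain.normalizerChain n k ≤ NormalizerChain.sylowSigma n ∧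
      IsPGroup 2 (NormalizerChain.normalizerChain n k)) ∧
    (∃ d : ℕ, ∀ k : ℕ, d ≤ k →
      NormalizerChain.normalizerChain n k = NormalizerChain.sylowSigma n) := by
  open NormalizerChain in
  refine ⟨exists_sylow_eq_of_normalizer_le (isPGroup_sylowSigma n)
    (normalizer_le_sylowSigma inf_le_left le_rfl), fun k hk => ?_, fun k => ?_,
    exists_normalizerChain_eq_sylowSigma n⟩
  · obtain ⟨k, rfl⟩ := Nat.exists_eq_succ_of_ne_zero (Nat.one_le_iff_ne_zero.mp hk)
    exact (inf_eq_right.mpr (normalizerChain_le_sylowSigma n (k + 1))).symm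
  · have hle := normalizerChain_le_sylowSigma n k
    exact ⟨hle, (isPGroup_sylowSigma n).to_le hle⟩
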